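/- Let $p$ be a prime and let $F$ be a free group of rank $2$. For a finitely generated group $K$ let $d(K)$ denote the least cardinality of a generating set of $K$. Let $\{P_n\}_{n\ge 1}$ be the lower $p$-central series of $F$, defined by $P_1=F$ and $P_{n+1}=P_n^p\,[F,P_n]$, where $P_n^p$ is the subgroup generated by the $p$-th powers of the elements of $P_n$. For $n\ge 1$ put $$U_n=\{(x,y)\in F\times F : xP_n=yP_n\}.$$ Then the following hold. (1) For every $n\ge 1$, $P_{n+1}\le P_n$ and the quotient $P_n/P_{n+1}$ is a finite elementary abelian $p$-group. Write $|P_n/P_{n+1}|=p^{a_n}$ and $b_n=\sum_{i=1}^n a_i$ (so $b_0=0$). Then $U_n$ has finite index in $F\times F$, with $$[F\times F:U_n]=p^{b_{n-1}}=[F\times\{1\}:(F\times\{1\})\cap U_n],$$ there is a surjective homomorphism $U_n\to P_n/P_{n+1}$, and $d(U_n)\ge a_n$. (2) For every $\varepsilon>0$ there are infinitely many $n$ with $b_{n-1}>0$ and $$\frac{d(U_n)}{\log_p[F\times F:U_n]}\ \ge\ \frac{a_n}{b_{n-1}}\ \ge\ 1-\varepsilon ,$$ and hence $d(U_n)\ge(1-\varepsilon)\log_p[F\times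 F:U_n]$. (3) Consequently a logarithmic bound on the number of generators in terms of the index would be sharp up to a constant: if $f\colon\mathbb N\to\mathbb R$ satisfies $d(H)\le f([F\times F:H])$ for every finite index subgroup $H\le F\times F$ that projects onto both factors, then for every $\varepsilon>0$ there are infinitely many $m$ with $f(m)\ge(1-\varepsilon)\log_p m$. -/

import Mathlib

open Filter

/-- The subgroup `N^p` generated by the `p`-th powers of the elements of `N`. -/
def powSubgroup {G : Type*} [Group G] (p : ℕ) (N : Subgroup G) : Subgroup G :=
  Subgroup.closure {x | ∃ g ∈ N, g ^ p = x}

instance powSubgroup_normal {G : Type*} [Group G] (p : ℕ) (N : Subgroup G) [hN : N.Normal] :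
    (powSubgroup p N).Normal := by
  refine ⟨fun x hx g => ?_⟩
  induction hx using Subgroup.closure_induction with
  | mem x hx =>
    obtain ⟨y, hy, rfl⟩ := hx
    exact Subgroup.subset_closure ⟨g * y * g⁻¹, hN.conj_mem y hy g, conj_pow⟩
  | one => simp
  | mul x y _ _ hx hy => simpa [mul_assoc] using mul_mem hx hy
  | inv x _ hx => simpa [mul_assoc] using inv_mem hx

/-- The lower `p`-central series `P₁ = G`, `Pₙ₊₁ = Pₙ^p [G, Pₙ]` for `n ≥ 1`, indexed from `1`
(with the harmless value `P₀ = G`). The product of these two normal subgroups is their join. -/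
def lowerPCentral (G : Type*) [Group G] (p : ℕ) : ℕ → Subgroup G
  | 0 => ⊤
  | 1 => ⊤
  | n + 2 => powSubgroup p (lowerPCentral G p (n + 1)) ⊔ ⁅(⊤ : Subgroup G), lowerPCentral G p (n + 1)⁆

instance lowerPCentral_normal (G : Type*) [Group G] (p : ℕ) (n : ℕ) :
    (lowerPCentral G p n).Normal := by
  induction n using lowerPCentral.induct with
  | case1 => rw [lowerPCentral]; infer_instance
  | case2 => rw [lowerPCentral]; infer_instance
  | case3 n ih => rw [lowerPCentral]; infer_instance

/-- The successive quotient `Pₙ / Pₙ₊₁`. -/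
abbrev pCentralQuotient (G : Type*) [Group G] (p n : ℕ) : Type _ :=
  lowerPCentral G p n ⧸ (lowerPCentral G p (n + 1)).subgroupOf (lowerPCentral G p n)

/-- `Uₙ = {(x, y) ∈ G × G : x Pₙ = y Pₙ}`. -/
def fiberSubgroup (G : Type*) [Group G] (p n : ℕ) : Subgroup (G × G) :=
  MonoidHom.eqLocus
    ((QuotientGroup.mk' (lowerPCentral G p n)).comp (MonoidHom.fst G G))
    ((QuotientGroup.mk' (lowerPCentral G p n)).comp (MonoidHom.snd G G))

/-- The exponent `aₙ` with `|Pₙ / Pₙ₊₁| = p ^ aₙ`, as the base-`p` logarithm of the order. -/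
noncomputable def pCentralExp (G : Type*) [Group G] (p n : ℕ) : ℕ :=
  Nat.log p (Nat.card (pCentralQuotient G p n))

/-- `bₙ = a₁ + ⋯ + aₙ`. -/
noncomputable def pCentralExpSum (G : Type*) [Group G] (p n : ℕ) : ℕ :=
  ∑ i ∈ Finset.Icc 1 n, pCentralExp G p i

/-- The free group of rank two. -/
abbrev F₂ : Type := FreeGroup (Fin 2)

/-! The map `(x, y) ↦ x y⁻¹` sends `Uₙ` onto `Pₙ / Pₙ₊₁`, so `d(Uₙ) ≥ aₙ`, and it identifies the
cosets of `Uₙ` with `F / Pₙ`, so the index is `p ^ bₙ₋₁`. It remains to find infinitely many `n`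
with `aₙ ≥ (1 - ε) bₙ₋₁`, that is `bₙ ≥ (2 - ε) bₙ₋₁`. Otherwise `bₙ = O((2 - ε)ⁿ)`, which
contradicts the bound `aₙ > (2 - s) s ^ (n - 1)` for `2 - ε < s < 2`.

That bound (`golodShafarevich_lowerPCentral`) is a Golod–Shafarevich argument for the finite
`p`-group `F / Pₙ`, dualised from the group algebra to functions. Let `h k` be the dimension of the
polynomial functions of degree `< k` on `F / Pₙ`, and let `E` be the space of functions on `F` all
of whose differences lie in this space. By freeness, differences along the two generators are
arbitrary, and constants are killed, so `dim E ≥ 2 h k + 1`. Differences along `aₙ` generators of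
`Pₙ` modulo `Pₙ₊₁` lower the degree by `n` and detect whether a function descends to `F / Pₙ`, so
`dim E ≤ aₙ h (k + 1 - n) + h (k + 1)`. If `aₙ` were too small, these inequalities would force `h`
to grow without bound, although `F / Pₙ` is finite. -/

open scoped commutatorElement

/-! ### Polynomial functions on a group and the lower `p`-central filtration -/

section PolynomialFunctions

variable {G : Type*} [Group G] {p : ℕ}

/-- The action of `G` on functions `G → 𝔽_p` by right translation. -/
def rightTranslation (G : Type*) [Group G] (p : ℕ) : G →* Module.End (ZMod p) (G → ZMod p) where
  toFun g := LinearMap.funLeft (ZMod p) (ZMod p) (· * g)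
  map_one' := by ext; simp [LinearMap.funLeft]
  map_mul' g h := by
    refine LinearMap.ext fun f => funext fun x => ?_
    simp [LinearMap.funLeft, mul_assoc]

@[simp]
theorem rightTranslation_apply (g : G) (f : G → ZMod p) (x : G) :
    rightTranslation G p g f x = f (x * g) := rfl

/-- The functions `G → 𝔽_p` killed by the `k`-th power of the augmentation ideal, that is, the
polynomial functions of degree less than `k`. -/
def polyFun (G : Type*) [Group G] (p : ℕ) : ℕ → Submodule (ZMod p) (G → ZMod p)
  | 0 => ⊥
  | k + 1 => ⨅ g, (polyFun G p k).comap (rightTranslation G p g - 1)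

theorem mem_polyFun_zero {f : G → ZMod p} : f ∈ polyFun G p 0 ↔ f = 0 := by
  simp [polyFun]

theorem mem_polyFun_succ {k : ℕ} {f : G → ZMod p} :
    f ∈ polyFun G p (k + 1) ↔ ∀ g, rightTranslation G p g f - f ∈ polyFun G p k := by
  simp [polyFun, Submodule.mem_iInf]

theorem polyFun_le_succ (k : ℕ) : polyFun G p k ≤ polyFun G p (k + 1) := by
  induction k with
  | zero => simp [polyFun]
  | succ k ih =>
    intro f hf
    rw [mem_polyFun_succ] at hf ⊢
    exact fun g => ih (hf g)

theorem polyFun_mono : Monotone (polyFun G p) := monotone_nat_of_le_succ polyFun_le_succ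

theorem rightTranslation_mem_polyFun {k : ℕ} {f : G → ZMod p} (hf : f ∈ polyFun G p k) (g : G) :
    rightTranslation G p g f ∈ polyFun G p k := by
  have := (polyFun G p k).add_mem (mem_polyFun_succ.1 (polyFun_le_succ k hf) g) hf
  simpa using this

/-- The elements `g` such that `g - 1` lowers the degree of polynomial functions by `m`. -/
def degreeLowering (G : Type*) [Group G] (p m : ℕ) : Subgroup G where
  -- Subtraction is truncated: for `k ≤ m` the condition says that `g` fixes `f`.
  carrier := {g | ∀ k, ∀ f ∈ polyFun G p k, rightTranslation G p g f - f ∈ polyFun G p (k - m)}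
  one_mem' k f _ := by simp
  mul_mem' {g h} hg hh k f hf := by
    have := add_mem (hg k _ (rightTranslation_mem_polyFun hf h)) (hh k f hf)
    simpa [Module.End.mul_apply] using this
  inv_mem' {g} hg k f hf := by
    have := neg_mem (hg k _ (rightTranslation_mem_polyFun hf g⁻¹))
    simpa [← Module.End.mul_apply, ← map_mul] using this

theorem sub_one_pow_apply_mem_polyFun {m : ℕ} {g : G} (hg : g ∈ degreeLowering G p m) (j : ℕ)
    {k : ℕ} {f : G → ZMod p} (hf : f ∈ polyFun G p k) :
    ((rightTranslation G p g - 1) ^ j) f ∈ polyFun G p (k - m * j) := by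
  induction j with
  | zero => simpa using hf
  | succ j ih =>
    rw [pow_succ', Module.End.mul_apply]
    have := hg _ _ ih
    rw [Nat.sub_sub] at this
    simpa [mul_add] using this

/-- The dual form of `Pₘ - 1 ⊆ Iᵐ`, with `I` the augmentation ideal: a `p`-th power multiplies the
depth by `p`, and a commutator with any element raises it by at least one. -/
theorem lowerPCentral_le_degreeLowering (hp : p.Prime) (m : ℕ) (hm : 1 ≤ m) :
    lowerPCentral G p m ≤ degreeLowering G p m := by
  have : Fact p.Prime := ⟨hp⟩
  induction m, hm using Nat.le_induction with
  | base =>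
    intro g _ k f hf
    cases k with
    | zero => simp [mem_polyFun_zero.1 hf]
    | succ k => simpa using mem_polyFun_succ.1 hf g
  | succ m hm ih =>
    obtain ⟨m, rfl⟩ := Nat.exists_eq_add_of_le' hm
    rw [lowerPCentral, sup_le_iff]
    constructor
    · rw [powSubgroup, Subgroup.closure_le]
      rintro _ ⟨g, hg, rfl⟩ k f hf
      have h := sub_one_pow_apply_mem_polyFun (ih hg) p hf
      -- Frobenius in characteristic `p`; the depth becomes at least twice the old one, which
      -- exceeds it by at least one since the old depth is positive.
      have : ((rightTranslation G p g - 1) ^ p) = rightTranslation G p (g ^ p) - 1 := by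
        have : CharP (Module.End (ZMod p) (G → ZMod p)) p :=
          charP_of_injective_algebraMap (algebraMap (ZMod p) _).injective p
        rw [sub_pow_char_of_commute _ (Commute.one_right _), one_pow, map_pow]
      rw [this] at h
      refine polyFun_mono ?_ h
      have := hp.two_le
      have : (m + 1) * 2 ≤ (m + 1) * p := Nat.mul_le_mul_left _ this
      omega
    · rw [Subgroup.commutator_le]
      intro g _ h hh k f hf
      set f' := rightTranslation G p (h * g)⁻¹ f with hf'
      have hf'k : f' ∈ polyFun G p k := rightTranslation_mem_polyFun hf _
      -- This is `[g, h] - 1 = ((g - 1)(h - 1) - (h - 1)(g - 1)) (hg)⁻¹`, applied to `f`.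
      have e : rightTranslation G p ⁅g, h⁆ f - f =
          (rightTranslation G p g (rightTranslation G p h f' - f') -
            (rightTranslation G p h f' - f')) -
          (rightTranslation G p h (rightTranslation G p g f' - f') -
            (rightTranslation G p g f' - f')) := by
        have h1 : rightTranslation G p ⁅g, h⁆ f =
            rightTranslation G p g (rightTranslation G p h f') := by
          rw [hf', ← Module.End.mul_apply, ← map_mul, ← Module.End.mul_apply, ← map_mul]
          congr 2
          simp [commutatorElement_def, mul_assoc]
        have h2 : f = rightTranslation G p h (rightTranslation G p g f') := by
          rw [hf', ← Module.End.mul_apply, ← map_mul, ← Module.End.mul_apply, ← map_mul]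
          simp [mul_assoc]
        rw [h1]
        conv_lhs => rw [h2]
        simp only [map_sub]
        abel
      rw [e]
      have one : ∀ j, ∀ u ∈ polyFun G p j, rightTranslation G p g u - u ∈ polyFun G p (j - 1) := by
        intro j u hu
        cases j with
        | zero => simp [mem_polyFun_zero.1 hu]
        | succ j => simpa using mem_polyFun_succ.1 hu g
      refine sub_mem ?_ ?_
      · have := one _ _ (ih hh k f' hf'k)
        rwa [Nat.sub_sub] at this
      · have := ih hh _ _ (one k f' hf'k)
        rwa [Nat.sub_sub, add_comm 1] at this

/-- The functions invariant under right translation by `N`. -/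
def invariantFun (p : ℕ) (N : Subgroup G) : Submodule (ZMod p) (G → ZMod p) :=
  ⨅ r ∈ N, LinearMap.ker (rightTranslation G p r - 1)

theorem mem_invariantFun {N : Subgroup G} {f : G → ZMod p} :
    f ∈ invariantFun p N ↔ ∀ r ∈ N, rightTranslation G p r f = f := by
  simp [invariantFun, Submodule.mem_iInf, sub_eq_zero]

theorem rightTranslation_mem_invariantFun {N : Subgroup G} [hN : N.Normal] {f : G → ZMod p}
    (hf : f ∈ invariantFun p N) (g : G) : rightTranslation G p g f ∈ invariantFun p N := by
  rw [mem_invariantFun] at hf ⊢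
  intro r hr
  have := hf (g⁻¹ * r * g) (by simpa using hN.conj_mem r hr g⁻¹)
  conv_rhs => rw [← this]
  simp only [← Module.End.mul_apply, ← map_mul]
  congr 2
  group

/-- Invariant functions are pulled back from the finite set `G ⧸ N`. -/
theorem finite_invariantFun [Fact p.Prime] (N : Subgroup G) [N.FiniteIndex] :
    Module.Finite (ZMod p) (invariantFun p N) := by
  have : Module.Finite (ZMod p) (LinearMap.range
      (LinearMap.funLeft (ZMod p) (ZMod p) (QuotientGroup.mk : G → G ⧸ N))) := inferInstance
  refine Submodule.finiteDimensional_of_le (S₂ := LinearMap.range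
      (LinearMap.funLeft (ZMod p) (ZMod p) (QuotientGroup.mk : G → G ⧸ N))) ?_
  intro f hf
  rw [mem_invariantFun] at hf
  refine ⟨fun q => Quotient.liftOn' q f ?_, ?_⟩
  · intro a b hab
    rw [QuotientGroup.leftRel_apply] at hab
    have := congrFun (hf _ hab) a
    simpa using this.symm
  · ext x
    rfl

end PolynomialFunctions

/-! ### Upper bound for functions with prescribed differences -/

section GolodShafarevich

variable {G : Type*} [Group G] {p : ℕ}

/-- The functions `f` with `g f - f ∈ V` for all `g`. -/
def differencesIn (V : Submodule (ZMod p) (G → ZMod p)) : Submodule (ZMod p) (G → ZMod p) :=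
  ⨅ g, V.comap (rightTranslation G p g - 1)

theorem mem_differencesIn {V : Submodule (ZMod p) (G → ZMod p)} {f : G → ZMod p} :
    f ∈ differencesIn V ↔ ∀ g, rightTranslation G p g f - f ∈ V := by
  simp [differencesIn, Submodule.mem_iInf]

/-- The polynomial functions of degree less than `k` on the quotient by `N`. -/
def invariantPolyFun (p : ℕ) (N : Subgroup G) (k : ℕ) : Submodule (ZMod p) (G → ZMod p) :=
  polyFun G p k ⊓ invariantFun p N

theorem rightTranslation_mem_invariantPolyFun {N : Subgroup G} [N.Normal] {k : ℕ}
    {f : G → ZMod p} (hf : f ∈ invariantPolyFun p N k) (g : G) :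
    rightTranslation G p g f ∈ invariantPolyFun p N k :=
  ⟨rightTranslation_mem_polyFun hf.1 g, rightTranslation_mem_invariantFun hf.2 g⟩

theorem finite_invariantPolyFun [Fact p.Prime] (N : Subgroup G) [N.FiniteIndex] (k : ℕ) :
    Module.Finite (ZMod p) (invariantPolyFun p N k) :=
  have := finite_invariantFun (p := p) N
  Submodule.finiteDimensional_of_le (S₂ := invariantFun p N) inf_le_right

theorem differencesIn_invariantPolyFun_le (N : Subgroup G) (k : ℕ) :
    differencesIn (invariantPolyFun p N k) ≤ polyFun G p (k + 1) := by
  intro f hf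
  rw [mem_differencesIn] at hf
  exact mem_polyFun_succ.2 fun g => (hf g).1

theorem differencesIn_inf_invariantFun_le (N : Subgroup G) (k : ℕ) :
    differencesIn (invariantPolyFun p N k) ⊓ invariantFun p N ≤ invariantPolyFun p N (k + 1) :=
  inf_le_inf_right _ (differencesIn_invariantPolyFun_le N k)

/-- If `S` generates `Pₙ` modulo `Pₙ₊₁`, then a polynomial function whose differences are
`Pₙ`-invariant is itself `Pₙ`-invariant as soon as it is fixed by `S`. -/
theorem mem_invariantFun_of_fixed (n : ℕ) (hn : 1 ≤ n) {S : Set G}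
    (hS : lowerPCentral G p n ≤ Subgroup.closure S ⊔ lowerPCentral G p (n + 1))
    (hSn : S ⊆ lowerPCentral G p n) {k : ℕ} {f : G → ZMod p} (hf : f ∈ polyFun G p k)
    (hd : f ∈ differencesIn (invariantFun p (lowerPCentral G p n)))
    (hfix : ∀ r ∈ S, rightTranslation G p r f = f) :
    f ∈ invariantFun p (lowerPCentral G p n) := by
  set R := lowerPCentral G p n with hR
  have hRn : R.Normal := lowerPCentral_normal G p n
  rw [mem_differencesIn] at hd
  -- Invariance of the differences makes `r ↦ r f - f` a homomorphism on `R`; by `hconj` below it is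
  -- equivariant for conjugation by `G`.
  have hmul : ∀ r ∈ R, ∀ s, rightTranslation G p (r * s) f - f =
      (rightTranslation G p r f - f) + (rightTranslation G p s f - f) := by
    intro r hr s
    have := mem_invariantFun.1 (hd s) r hr
    rw [map_sub, sub_eq_iff_eq_add] at this
    rw [map_mul, Module.End.mul_apply, this]
    abel
  have hinv : ∀ r ∈ R, rightTranslation G p r⁻¹ f - f = -(rightTranslation G p r f - f) := by
    intro r hr
    have := hmul r hr r⁻¹
    rw [mul_inv_cancel, map_one, Module.End.one_apply, sub_self] at this
    exact (neg_eq_of_add_eq_zero_right this.symm).symm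
  have hpow : ∀ r ∈ R, ∀ j : ℕ, rightTranslation G p (r ^ j) f - f =
      j • (rightTranslation G p r f - f) := by
    intro r hr j
    induction j with
    | zero => simp
    | succ j ih => rw [pow_succ', hmul r hr, ih, succ_nsmul']
  have hconj : ∀ r ∈ R, ∀ g, rightTranslation G p (g * r * g⁻¹) f - f =
      rightTranslation G p g (rightTranslation G p r f - f) := by
    intro r hr g
    have h1 := mem_invariantFun.1 (hd g⁻¹) r hr
    rw [map_sub] at h1
    have h2 : rightTranslation G p r (rightTranslation G p g⁻¹ f) =
        rightTranslation G p g⁻¹ f + (rightTranslation G p r f - f) := by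
      linear_combination (exp := 1) h1
    rw [map_mul, map_mul, Module.End.mul_apply, Module.End.mul_apply, h2, map_add,
      ← Module.End.mul_apply, ← map_mul]
    simp
  -- Each round lowers the degree of all the values `r f - f` by one: the value is zero on `S` and
  -- on `p`-th powers, and on `[g, r]` it is `(g - 1)(r f - f)`. Since `S` and `Pₙ₊₁` generate `R`,
  -- after `k` rounds every value is zero.
  have key : ∀ i, ∀ r ∈ R, rightTranslation G p r f - f ∈ polyFun G p (k - i) := by
    intro i
    induction i with
    | zero =>
      exact fun r _ => sub_mem (rightTranslation_mem_polyFun hf r) hf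
    | succ i ih =>
      have ih' : ∀ g, ∀ r ∈ R, rightTranslation G p g (rightTranslation G p r f - f) -
          (rightTranslation G p r f - f) ∈ polyFun G p (k - (i + 1)) := by
        intro g r hr
        have := ih r hr
        rw [← Nat.sub_sub]
        cases h : k - i with
        | zero => rw [h] at this; simp [mem_polyFun_zero.1 this]
        | succ j => rw [h] at this; exact mem_polyFun_succ.1 this g
      let S' : Subgroup G :=
        { carrier := {r | r ∈ R ∧ rightTranslation G p r f - f ∈ polyFun G p (k - (i + 1))}
          one_mem' := ⟨one_mem _, by simp⟩
          mul_mem' := fun {a b} ha hb => ⟨mul_mem ha.1 hb.1, by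
            rw [hmul a ha.1]; exact add_mem ha.2 hb.2⟩
          inv_mem' := fun {a} ha => ⟨inv_mem ha.1, by
            rw [hinv a ha.1]; exact neg_mem ha.2⟩ }
      have hle : R ≤ S' := by
        refine hS.trans (sup_le ?_ ?_)
        · rw [Subgroup.closure_le]
          exact fun r hr => ⟨hSn hr, by simp [hfix r hr]⟩
        · obtain ⟨m, rfl⟩ := Nat.exists_eq_add_of_le' hn
          rw [lowerPCentral, sup_le_iff]
          constructor
          · rw [powSubgroup, Subgroup.closure_le]
            rintro _ ⟨g, hg, rfl⟩
            refine ⟨pow_mem hg p, ?_⟩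
            rw [hpow g hg]
            have : p • (rightTranslation G p g f - f) = 0 := by
              ext x; simp
            simp [this]
          · rw [Subgroup.commutator_le]
            intro g _ r hr
            have hc : g * r * g⁻¹ ∈ R := hRn.conj_mem r hr g
            refine ⟨mul_mem hc (inv_mem hr), ?_⟩
            rw [commutatorElement_def, hmul _ hc, hinv r hr, hconj r hr, ← sub_eq_add_neg]
            exact ih' g r hr
      exact fun r hr => (hle hr).2
  rw [mem_invariantFun]
  intro r hr
  have := key k r hr
  rw [Nat.sub_self, mem_polyFun_zero] at this
  exact sub_eq_zero.1 this

/-- Rank–nullity for `φ` restricted to `E`, where the finite dimension of `E` is itself deduced from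
that of image and kernel. -/
theorem Submodule.finite_of_finite_map_of_finite_inf_ker {K V W : Type*} [Field K] [AddCommGroup V]
    [Module K V] [AddCommGroup W] [Module K W] (E : Submodule K V) (φ : V →ₗ[K] W)
    [h₁ : Module.Finite K (E.map φ)] [h₂ : Module.Finite K (E ⊓ LinearMap.ker φ : Submodule K V)] :
    Module.Finite K E ∧ Module.finrank K E = Module.finrank K (E.map φ) +
      Module.finrank K (E ⊓ LinearMap.ker φ : Submodule K V) := by
  have hr : LinearMap.range (φ.domRestrict E) = E.map φ := LinearMap.range_domRestrict E φ
  have hk : LinearMap.ker (φ.domRestrict E) =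
      (E ⊓ LinearMap.ker φ : Submodule K V).comap E.subtype := by
    ext x; simp
  let e := Submodule.comapSubtypeEquivOfLe (inf_le_left : E ⊓ LinearMap.ker φ ≤ E)
  have : Module.Finite K (LinearMap.ker (φ.domRestrict E)) := by
    rw [hk]; exact Module.Finite.equiv e.symm
  have : Module.Finite K (LinearMap.range (φ.domRestrict E)) := by rwa [hr]
  have : Module.Finite K (E ⧸ LinearMap.ker (φ.domRestrict E)) :=
    Module.Finite.equiv (φ.domRestrict E).quotKerEquivRange.symm
  have fin : Module.Finite K E := Module.Finite.of_submodule_quotient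
    (LinearMap.ker (φ.domRestrict E))
  refine ⟨fin, ?_⟩
  rw [← LinearMap.finrank_range_add_finrank_ker (φ.domRestrict E), hr, hk, e.finrank_eq]

/-- The upper bound for the dimension of the space of functions with differences in
`invariantPolyFun p Pₙ k` in terms of generators of `Pₙ` modulo `Pₙ₊₁`. -/
theorem finrank_differencesIn_le (hp : p.Prime) (n : ℕ) (hn : 1 ≤ n)
    [(lowerPCentral G p n).FiniteIndex] {a : ℕ} (r : Fin a → G)
    (hr : ∀ i, r i ∈ lowerPCentral G p n)
    (hS : lowerPCentral G p n ≤ Subgroup.closure (Set.range r) ⊔ lowerPCentral G p (n + 1))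
    (k : ℕ) :
    Module.Finite (ZMod p) (differencesIn (invariantPolyFun p (lowerPCentral G p n) k)) ∧
    Module.finrank (ZMod p) (differencesIn (invariantPolyFun p (lowerPCentral G p n) k)) ≤
      a * Module.finrank (ZMod p) (invariantPolyFun p (lowerPCentral G p n) (k + 1 - n)) +
      Module.finrank (ZMod p) (invariantPolyFun p (lowerPCentral G p n) (k + 1)) := by
  have : Fact p.Prime := ⟨hp⟩
  set R := lowerPCentral G p n with hR
  have fin := fun k => finite_invariantPolyFun (p := p) R k
  let φ : (G → ZMod p) →ₗ[ZMod p] (Fin a → G → ZMod p) :=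
    LinearMap.pi fun i => rightTranslation G p (r i) - 1
  set E := differencesIn (invariantPolyFun p R k)
  set V := invariantPolyFun p R (k + 1 - n)
  let ψ : (Fin a → V) →ₗ[ZMod p] (Fin a → G → ZMod p) :=
    LinearMap.pi fun i => V.subtype ∘ₗ LinearMap.proj i
  -- Elements of `E` have degree `< k + 1`, and `r i` lies in `Pₙ`, so the difference along `r i`
  -- has degree `< k + 1 - n`.
  have hmap : E.map φ ≤ LinearMap.range ψ := by
    rintro _ ⟨f, hf, rfl⟩
    have hf' : ∀ i, rightTranslation G p (r i) f - f ∈ V := fun i =>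
      ⟨lowerPCentral_le_degreeLowering hp n hn (hr i) _ _
        (differencesIn_invariantPolyFun_le R k hf), (mem_differencesIn.1 hf (r i)).2⟩
    exact ⟨fun i => ⟨_, hf' i⟩, rfl⟩
  -- Being fixed by the `r i` forces invariance under all of `Pₙ`, even though they generate it only
  -- modulo `Pₙ₊₁`.
  have hker : E ⊓ LinearMap.ker φ ≤ invariantPolyFun p R (k + 1) := by
    rintro f ⟨hf, hf'⟩
    refine differencesIn_inf_invariantFun_le R k ⟨hf, ?_⟩
    refine mem_invariantFun_of_fixed n hn hS ?_ (differencesIn_invariantPolyFun_le R k hf) ?_ ?_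
    · rintro _ ⟨i, rfl⟩; exact hr i
    · exact mem_differencesIn.2 fun g => (mem_differencesIn.1 hf g).2
    · rintro _ ⟨i, rfl⟩
      exact sub_eq_zero.1 (congrFun (LinearMap.mem_ker.1 hf') i)
  have f1 : Module.Finite (ZMod p) (E.map φ) := Submodule.finiteDimensional_of_le hmap
  have f2 : Module.Finite (ZMod p) (E ⊓ LinearMap.ker φ : Submodule (ZMod p) (G → ZMod p)) :=
    Submodule.finiteDimensional_of_le hker
  obtain ⟨h1, h2⟩ := Submodule.finite_of_finite_map_of_finite_inf_ker E φ
  refine ⟨h1, ?_⟩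
  rw [h2]
  refine add_le_add ((Submodule.finrank_mono hmap).trans ?_) (Submodule.finrank_mono hker)
  refine (LinearMap.finrank_range_le ψ).trans_eq ?_
  rw [Module.finrank_pi_fintype]
  simp

end GolodShafarevich

/-! ### Lower bound from freeness and the Golod–Shafarevich inequality -/

section FreeGroup

variable {p : ℕ}

/-- On a free group, the differences along the free generators can be prescribed. -/
theorem exists_freeGroup_differences_eq {ι : Type*} (c : ι → FreeGroup ι → ZMod p) :
    ∃ f : FreeGroup ι → ZMod p,
      ∀ i, rightTranslation (FreeGroup ι) p (FreeGroup.of i) f - f = c i := by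
  let ρ := rightTranslation (FreeGroup ι) p
  have hρ : ∀ g v, ρ g (ρ g⁻¹ v) = v := fun g v => by
    rw [← Module.End.mul_apply, ← map_mul]; simp
  have hρ' : ∀ g v, ρ g⁻¹ (ρ g v) = v := fun g v => by
    rw [← Module.End.mul_apply, ← map_mul]; simp
  -- The generators act by the affine maps `v ↦ ρ(i) v + c i`; freeness extends this to an action,
  -- whose translation part `g ↦ A g 0` is a cocycle with value `c i` at the `i`-th generator.
  let A : FreeGroup ι →* Equiv.Perm (FreeGroup ι → ZMod p) := FreeGroup.lift fun i =>
    { toFun := fun v => ρ (FreeGroup.of i) v + c i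
      invFun := fun v => ρ (FreeGroup.of i)⁻¹ (v - c i)
      left_inv := fun v => by simp only [add_sub_cancel_right, hρ']
      right_inv := fun v => by simp only [hρ, sub_add_cancel] }
  have hA : ∀ i v, A (FreeGroup.of i) v = ρ (FreeGroup.of i) v + c i := fun i v => by
    simp [A]
  have haff : ∀ g v, A g v = ρ g v + A g 0 := by
    intro g
    induction g using FreeGroup.induction_on with
    | C1 => intro v; simp
    | of i => intro v; rw [hA, hA]; simp
    | inv_of i h =>
      have : ∀ v, A (FreeGroup.of i)⁻¹ v = ρ (FreeGroup.of i)⁻¹ (v - c i) := by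
        intro v
        rw [map_inv, Equiv.Perm.inv_eq_iff_eq, hA, hρ, sub_add_cancel]
      intro v
      rw [this, this, map_sub, map_sub, map_zero, zero_sub, sub_eq_add_neg]
    | mul g h hg hh =>
      intro v
      rw [map_mul, map_mul, Equiv.Perm.mul_apply, Equiv.Perm.mul_apply, hg, hh, hg (A h 0),
        map_add, Module.End.mul_apply, add_assoc]
  -- Evaluating the cocycle at `1` gives `f`: the cocycle rule turns `f (x * of i) - f x` into `(ρ x
  -- (c i)) 1 = c i x`.
  refine ⟨fun x => A x 0 1, fun i => funext fun x => ?_⟩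
  have : A (x * FreeGroup.of i) 0 = ρ x (c i) + A x 0 := by
    rw [map_mul, Equiv.Perm.mul_apply, haff, hA]; simp
  rw [Pi.sub_apply, rightTranslation_apply, this, Pi.add_apply]
  simp [ρ]

/-- Differences extend to words by `gh - 1 = g (h - 1) + (g - 1)` and `g⁻¹ - 1 = -g⁻¹ (g - 1)`,
using that `V` is stable under translation. -/
theorem mem_differencesIn_of_freeGroup_generators {ι : Type*}
    {V : Submodule (ZMod p) (FreeGroup ι → ZMod p)}
    (hV : ∀ g, ∀ v ∈ V, rightTranslation (FreeGroup ι) p g v ∈ V) {f : FreeGroup ι → ZMod p}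
    (hf : ∀ i, rightTranslation (FreeGroup ι) p (FreeGroup.of i) f - f ∈ V) :
    f ∈ differencesIn V := by
  rw [mem_differencesIn]
  intro g
  induction g using FreeGroup.induction_on with
  | C1 => simp
  | of i => exact hf i
  | inv_of i h =>
    have := neg_mem (hV (FreeGroup.of i)⁻¹ _ h)
    simpa [← Module.End.mul_apply, ← map_mul] using this
  | mul g h hg hh =>
    have := add_mem (hV g _ hh) hg
    simpa [Module.End.mul_apply] using this

/-- The two differences along the generators map `differencesIn V` onto `V × V`, and the kernel
contains the constants. -/
theorem two_mul_finrank_add_one_le_finrank_differencesIn (hp : p.Prime)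
    {V : Submodule (ZMod p) (F₂ → ZMod p)} [Module.Finite (ZMod p) V]
    [Module.Finite (ZMod p) (differencesIn V)]
    (hV : ∀ g, ∀ v ∈ V, rightTranslation F₂ p g v ∈ V) :
    2 * Module.finrank (ZMod p) V + 1 ≤ Module.finrank (ZMod p) (differencesIn V) := by
  have : Fact p.Prime := ⟨hp⟩
  set E := differencesIn V
  let φ : E →ₗ[ZMod p] (Fin 2 → V) := LinearMap.pi fun i =>
    LinearMap.restrict (rightTranslation F₂ p (FreeGroup.of i) - 1)
      fun f hf => mem_differencesIn.1 hf _
  have hφ : ∀ (f : E) i, (φ f i : F₂ → ZMod p) =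
      rightTranslation F₂ p (FreeGroup.of i) f - f := fun f i => rfl
  have hsurj : Function.Surjective φ := by
    intro c
    obtain ⟨f, hf⟩ := exists_freeGroup_differences_eq fun i => (c i : F₂ → ZMod p)
    refine ⟨⟨f, mem_differencesIn_of_freeGroup_generators hV fun i => ?_⟩, ?_⟩
    · rw [hf]; exact (c i).2
    · ext1 i
      exact Subtype.ext ((hφ _ i).trans (hf i))
  have hone : (fun _ => 1 : F₂ → ZMod p) ∈ E := mem_differencesIn.2 fun g => by
    convert V.zero_mem
    ext; simp
  have hker : 1 ≤ Module.finrank (ZMod p) (LinearMap.ker φ) := by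
    rw [Nat.one_le_iff_ne_zero, ← Nat.pos_iff_ne_zero, Module.finrank_pos_iff_exists_ne_zero]
    refine ⟨⟨⟨_, hone⟩, ?_⟩, ?_⟩
    · rw [LinearMap.mem_ker]
      ext i x
      rw [hφ]
      simp
    · intro h
      have := congrFun (congrArg Subtype.val (congrArg Subtype.val h)) 1
      simp at this
  rw [← LinearMap.finrank_range_add_finrank_ker φ, LinearMap.range_eq_top.2 hsurj, finrank_top,
    Module.finrank_pi_fintype]
  simpa using hker

/-- The lower bound of Golod–Shafarevich type for the number of generators of `Pₙ` modulo
`Pₙ₊₁` in the free group of rank two. -/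
theorem golodShafarevich_lowerPCentral (hp : p.Prime) (n : ℕ) (hn : 1 ≤ n)
    [(lowerPCentral F₂ p n).FiniteIndex] {a : ℕ} (r : Fin a → F₂)
    (hr : ∀ i, r i ∈ lowerPCentral F₂ p n)
    (hS : lowerPCentral F₂ p n ≤ Subgroup.closure (Set.range r) ⊔ lowerPCentral F₂ p (n + 1))
    {s : ℝ} (hs : 1 < s) : (2 - s) * s ^ (n - 1) < a := by
  have : Fact p.Prime := ⟨hp⟩
  by_contra! hcon
  set R := lowerPCentral F₂ p n with hR
  have fin := fun k => finite_invariantPolyFun (p := p) R k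
  have fin' := finite_invariantFun (p := p) R
  set h : ℕ → ℕ := fun k => Module.finrank (ZMod p) (invariantPolyFun p R k) with hh
  have hrec : ∀ k, (2 * h k + 1 : ℝ) ≤ a * h (k + 1 - n) + h (k + 1) := by
    intro k
    obtain ⟨f1, h1⟩ := finrank_differencesIn_le hp n hn r hr hS k
    have h2 := two_mul_finrank_add_one_le_finrank_differencesIn hp
      (V := invariantPolyFun p R k) fun g v hv => rightTranslation_mem_invariantPolyFun hv g
    exact_mod_cast h2.trans h1
  have hbdd : ∀ k, h k ≤ Module.finrank (ZMod p) (invariantFun p R) := fun k =>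
    Submodule.finrank_mono inf_le_right
  have h0 : h 0 = 0 := by
    have : invariantPolyFun p R 0 = ⊥ := by simp [invariantPolyFun, polyFun]
    rw [hh]
    beta_reduce
    rw [this, finrank_bot]
  have hs0 : 0 < s := by linarith
  -- The assumption to be refuted, `a ≤ (2 - s) s ^ (n - 1)`, already excludes `s > 2`.
  have h2s : 0 ≤ 2 - s := by
    by_contra! hneg
    have := mul_neg_of_neg_of_pos hneg (pow_pos hs0 (n - 1))
    have : (0 : ℝ) ≤ a := by positivity
    linarith
  -- Growth below `k` gives `s ^ (n - 1) h (k + 1 - n) ≤ h k`, so the relator term in `hrec` is at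
  -- most `(2 - s) h k`, leaving `s h k + 1`. When `n > k + 1` the truncated index is `0` and the
  -- term vanishes.
  have hgrow : ∀ k, s * h k + 1 ≤ h (k + 1) := by
    intro k
    induction k using Nat.strong_induction_on with
    | _ k ih =>
      have hchain : ∀ j i, i + j = k → s ^ j * (h i : ℝ) ≤ h k := by
        intro j
        induction j with
        | zero => intro i hi; simp at hi; simp [hi]
        | succ j ihj =>
          intro i hi
          have h1 := ihj (i + 1) (by omega)
          have h2 := ih i (by omega)
          calc s ^ (j + 1) * (h i : ℝ) = s ^ j * (s * h i) := by ring
            _ ≤ s ^ j * h (i + 1) := by gcongr; linarith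
            _ ≤ _ := h1
      have hlow : (a : ℝ) * h (k + 1 - n) ≤ (2 - s) * h k := by
        rcases le_or_gt n (k + 1) with hle | hlt
        · have h1 := hchain (n - 1) (k + 1 - n) (by omega)
          calc (a : ℝ) * h (k + 1 - n) ≤ (2 - s) * s ^ (n - 1) * h (k + 1 - n) := by gcongr
            _ = (2 - s) * (s ^ (n - 1) * h (k + 1 - n)) := by ring
            _ ≤ _ := by gcongr
        · rw [Nat.sub_eq_zero_of_le hlt.le, h0]
          simp only [Nat.cast_zero, mul_zero]
          positivity
      have := hrec k
      linarith
  have hunb : ∀ k, k ≤ h k := by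
    intro k
    induction k with
    | zero => simp
    | succ k ih =>
      have h1 := hgrow k
      have h2 : (h k : ℝ) ≤ s * h k := le_mul_of_one_le_left (by positivity) hs.le
      have : (h k : ℝ) + 1 ≤ h (k + 1) := by linarith
      have : h k + 1 ≤ h (k + 1) := by exact_mod_cast this
      omega
  exact absurd (hbdd _) (not_le.2 (Nat.lt_of_succ_le (hunb _)))

end FreeGroup

/-! ### The quotients `Pₙ / Pₙ₊₁` and the fibre subgroups `Uₙ` -/

section LowerPCentral

variable {G : Type*} [Group G] {p : ℕ}

theorem pow_mem_lowerPCentral_succ {n : ℕ} (hn : 1 ≤ n) {g : G} (hg : g ∈ lowerPCentral G p n) :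
    g ^ p ∈ lowerPCentral G p (n + 1) := by
  obtain ⟨n, rfl⟩ := Nat.exists_eq_add_of_le' hn
  rw [lowerPCentral]
  exact Subgroup.mem_sup_left (Subgroup.subset_closure ⟨g, hg, rfl⟩)

theorem commutator_mem_lowerPCentral_succ {n : ℕ} (hn : 1 ≤ n) (g : G) {h : G}
    (hh : h ∈ lowerPCentral G p n) : ⁅g, h⁆ ∈ lowerPCentral G p (n + 1) := by
  obtain ⟨n, rfl⟩ := Nat.exists_eq_add_of_le' hn
  rw [lowerPCentral]
  exact Subgroup.mem_sup_right (Subgroup.commutator_mem_commutator (Subgroup.mem_top g) hh)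

theorem lowerPCentral_succ_le (n : ℕ) (hn : 1 ≤ n) :
    lowerPCentral G p (n + 1) ≤ lowerPCentral G p n := by
  obtain ⟨n, rfl⟩ := Nat.exists_eq_add_of_le' hn
  rw [lowerPCentral, sup_le_iff]
  constructor
  · rw [powSubgroup, Subgroup.closure_le]
    rintro _ ⟨g, hg, rfl⟩
    exact pow_mem hg p
  · exact Subgroup.commutator_le_right _ _

theorem pCentralQuotient_mul_comm {n : ℕ} (hn : 1 ≤ n) (x y : pCentralQuotient G p n) :
    x * y = y * x := by
  induction x using QuotientGroup.induction_on with | _ x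
  induction y using QuotientGroup.induction_on with | _ y
  rw [← QuotientGroup.mk_mul, ← QuotientGroup.mk_mul, QuotientGroup.eq, Subgroup.mem_subgroupOf]
  have := commutator_mem_lowerPCentral_succ hn (y⁻¹ : G) (inv_mem x.2)
  simpa [commutatorElement_def, mul_assoc] using this

theorem pCentralQuotient_pow_eq_one {n : ℕ} (hn : 1 ≤ n) (x : pCentralQuotient G p n) :
    x ^ p = 1 := by
  induction x using QuotientGroup.induction_on with | _ x
  rw [← QuotientGroup.mk_pow, QuotientGroup.eq_one_iff, Subgroup.mem_subgroupOf]
  exact pow_mem_lowerPCentral_succ hn x.2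

/-- The quotient `Pₙ / Pₙ₊₁` as a commutative group. -/
abbrev pCentralQuotientCommGroup (G : Type*) [Group G] (p : ℕ) {n : ℕ} (hn : 1 ≤ n) :
    CommGroup (pCentralQuotient G p n) :=
  { (inferInstance : Group (pCentralQuotient G p n)) with
    mul_comm := pCentralQuotient_mul_comm hn }

theorem finite_pCentralQuotient (hp : p.Prime) {n : ℕ} (hn : 1 ≤ n)
    [Group.FG (lowerPCentral G p n)] : Finite (pCentralQuotient G p n) := by
  let := pCentralQuotientCommGroup G p hn
  have : Group.FG (pCentralQuotient G p n) := QuotientGroup.fg _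
  refine CommGroup.finite_of_fg_isMulTorsion _ fun x => ?_
  exact isOfFinOrder_iff_pow_eq_one.2 ⟨p, hp.pos, pCentralQuotient_pow_eq_one hn x⟩

theorem card_pCentralQuotient (hp : p.Prime) {n : ℕ} (hn : 1 ≤ n)
    [Group.FG (lowerPCentral G p n)] :
    Nat.card (pCentralQuotient G p n) = p ^ pCentralExp G p n := by
  have : Fact p.Prime := ⟨hp⟩
  have := finite_pCentralQuotient (G := G) hp hn
  have hG : IsPGroup p (pCentralQuotient G p n) := fun x =>
    ⟨1, by rw [pow_one]; exact pCentralQuotient_pow_eq_one hn x⟩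
  obtain ⟨a, ha⟩ := IsPGroup.iff_card.1 hG
  rw [pCentralExp, ha, Nat.log_pow hp.one_lt]

theorem card_pCentralQuotient_mul_index {n : ℕ} (hn : 1 ≤ n) :
    Nat.card (pCentralQuotient G p n) * (lowerPCentral G p n).index =
      (lowerPCentral G p (n + 1)).index :=
  Subgroup.relIndex_mul_index (lowerPCentral_succ_le n hn)

/-- By induction: a finite index subgroup of a finitely generated group is finitely generated, so
`Pₙ / Pₙ₊₁` is a finitely generated abelian group of exponent dividing `p`, hence finite. -/
theorem finiteIndex_lowerPCentral [Group.FG G] (hp : p.Prime) {n : ℕ} (hn : 1 ≤ n) :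
    (lowerPCentral G p n).FiniteIndex := by
  induction n, hn using Nat.le_induction with
  | base => rw [lowerPCentral]; infer_instance
  | succ n hn ih =>
    constructor
    rw [← card_pCentralQuotient_mul_index hn, card_pCentralQuotient hp hn]
    exact mul_ne_zero (pow_ne_zero _ hp.ne_zero) ih.index_ne_zero

theorem pCentralExpSum_succ (n : ℕ) :
    pCentralExpSum G p (n + 1) = pCentralExpSum G p n + pCentralExp G p (n + 1) :=
  Finset.sum_Icc_succ_top (by omega) _

theorem index_lowerPCentral [Group.FG G] (hp : p.Prime) {n : ℕ} (hn : 1 ≤ n) :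
    (lowerPCentral G p n).index = p ^ pCentralExpSum G p (n - 1) := by
  induction n, hn using Nat.le_induction with
  | base => simp [lowerPCentral, pCentralExpSum]
  | succ n hn ih =>
    have := finiteIndex_lowerPCentral (G := G) hp hn
    rw [← card_pCentralQuotient_mul_index hn, card_pCentralQuotient hp hn, ih, ← pow_add]
    obtain ⟨n, rfl⟩ := Nat.exists_eq_add_of_le' hn
    simp [pCentralExpSum_succ, add_comm]

/-- An elementary abelian group of order `p ^ a` is generated by `a` elements. -/
theorem exists_generators_of_card_eq_pow {A : Type*} [CommGroup A] (hp : p.Prime)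
    (hA : ∀ x : A, x ^ p = 1) {a : ℕ} (ha : Nat.card A = p ^ a) :
    ∃ r : Fin a → A, Subgroup.closure (Set.range r) = ⊤ := by
  have : Fact p.Prime := ⟨hp⟩
  have : Finite A := Nat.finite_of_card_ne_zero (ha ▸ pow_ne_zero _ hp.ne_zero)
  let : Module (ZMod p) (Additive A) := AddCommGroup.zmodModule (n := p) hA
  have hrank : Module.finrank (ZMod p) (Additive A) = a := by
    have h := Module.natCard_eq_pow_finrank (K := ZMod p) (V := Additive A)
    rw [Nat.card_zmod] at h
    exact Nat.pow_right_injective hp.two_le (h.symm.trans ha)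
  let b := Module.finBasisOfFinrankEq (ZMod p) (Additive A) hrank
  refine ⟨fun i => (b i).toMul, ?_⟩
  rw [eq_top_iff]
  intro x _
  let S := Subgroup.toAddSubgroup (Subgroup.closure (Set.range fun i => (b i).toMul))
  have hS : Submodule.span (ZMod p) (Set.range b) ≤ AddSubgroup.toZModSubmodule p S := by
    rw [Submodule.span_le]
    rintro _ ⟨i, rfl⟩
    exact Subgroup.subset_closure (G := A) ⟨i, rfl⟩
  rw [b.span_eq] at hS
  have hx : Additive.ofMul x ∈ AddSubgroup.toZModSubmodule p S := hS Submodule.mem_top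
  exact hx

theorem exists_generators_lowerPCentral (hp : p.Prime) {n : ℕ} (hn : 1 ≤ n)
    [Group.FG (lowerPCentral G p n)] :
    ∃ r : Fin (pCentralExp G p n) → G, (∀ i, r i ∈ lowerPCentral G p n) ∧
      lowerPCentral G p n ≤ Subgroup.closure (Set.range r) ⊔ lowerPCentral G p (n + 1) := by
  let := pCentralQuotientCommGroup G p hn
  obtain ⟨q, hq⟩ := exists_generators_of_card_eq_pow hp
    (fun x => pCentralQuotient_pow_eq_one hn x) (card_pCentralQuotient (G := G) hp hn)
  choose r hr using fun i => QuotientGroup.mk_surjective (q i)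
  refine ⟨fun i => r i, fun i => (r i).2, ?_⟩
  set T := Subgroup.closure (Set.range fun i => (r i : G)) ⊔ lowerPCentral G p (n + 1)
  have hle : (lowerPCentral G p (n + 1)).subgroupOf (lowerPCentral G p n) ≤
      T.subgroupOf (lowerPCentral G p n) := Subgroup.comap_mono le_sup_right
  have hmap : (T.subgroupOf (lowerPCentral G p n)).map (QuotientGroup.mk'
      ((lowerPCentral G p (n + 1)).subgroupOf (lowerPCentral G p n))) = ⊤ := by
    rw [eq_top_iff]
    refine hq.symm.le.trans ((Subgroup.closure_le _).2 ?_)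
    rintro _ ⟨i, rfl⟩
    exact ⟨r i, Subgroup.mem_sup_left (Subgroup.subset_closure ⟨i, rfl⟩), hr i⟩
  have htop := congrArg (Subgroup.comap (QuotientGroup.mk'
    ((lowerPCentral G p (n + 1)).subgroupOf (lowerPCentral G p n)))) hmap
  rw [Subgroup.comap_map_eq, QuotientGroup.ker_mk', Subgroup.comap_top, sup_eq_left.2 hle] at htop
  exact Subgroup.subgroupOf_eq_top.1 htop

theorem mem_fiberSubgroup {n : ℕ} {x : G × G} :
    x ∈ fiberSubgroup G p n ↔ x.1 * x.2⁻¹ ∈ lowerPCentral G p n := by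
  rw [← QuotientGroup.eq_one_iff (N := lowerPCentral G p n), QuotientGroup.mk_mul,
    QuotientGroup.mk_inv, mul_inv_eq_one]
  rfl

/-- The homomorphism `Uₙ → Pₙ / Pₙ₊₁`, `(x, y) ↦ x y⁻¹`. -/
def fiberSubgroupToQuotient (G : Type*) [Group G] (p : ℕ) {n : ℕ} (hn : 1 ≤ n) :
    fiberSubgroup G p n →* pCentralQuotient G p n :=
  MonoidHom.mk' (fun x => QuotientGroup.mk ⟨x.1.1 * x.1.2⁻¹, mem_fiberSubgroup.1 x.2⟩) <| by
    rintro ⟨⟨a, b⟩, hx⟩ ⟨⟨c, d⟩, hy⟩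
    rw [← QuotientGroup.mk_mul, QuotientGroup.eq, Subgroup.mem_subgroupOf]
    -- The products `a c d⁻¹ b⁻¹` and `a b⁻¹ c d⁻¹` differ by a commutator of `b` with an element of
    -- `Pₙ`, which dies modulo `Pₙ₊₁`.
    have h := commutator_mem_lowerPCentral_succ hn b (inv_mem (mem_fiberSubgroup.1 hy))
    simpa [commutatorElement_def, mul_assoc] using h

theorem fiberSubgroupToQuotient_surjective {n : ℕ} (hn : 1 ≤ n) :
    Function.Surjective (fiberSubgroupToQuotient G p hn) := by
  intro q
  obtain ⟨x, rfl⟩ := QuotientGroup.mk_surjective q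
  refine ⟨⟨(x, 1), mem_fiberSubgroup.2 (by simp)⟩, ?_⟩
  simp [fiberSubgroupToQuotient]

/-- The map `(x, y) ↦ x y⁻¹` induces a bijection from cosets of `Uₙ` to `G ⧸ Pₙ`. It is only a map
of sets; normality of `Pₙ` makes it well defined and injective. -/
theorem index_fiberSubgroup (n : ℕ) :
    (fiberSubgroup G p n).index = (lowerPCentral G p n).index := by
  refine Nat.card_congr (Equiv.ofBijective (fun q => Quotient.liftOn' q
    (fun x : G × G => (QuotientGroup.mk (x.1 * x.2⁻¹) : G ⧸ lowerPCentral G p n)) ?_) ⟨?_, ?_⟩)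
  · intro x y h
    rw [QuotientGroup.leftRel_apply, mem_fiberSubgroup] at h
    rw [QuotientGroup.eq]
    have := (lowerPCentral_normal G p n).conj_mem _ h x.2
    simpa [mul_assoc] using this
  · intro q₁ q₂
    induction q₁ using Quotient.inductionOn' with | _ x
    induction q₂ using Quotient.inductionOn' with | _ y
    intro h
    refine Quotient.sound' ?_
    rw [QuotientGroup.leftRel_apply, mem_fiberSubgroup]
    have h' := (lowerPCentral_normal G p n).conj_mem _ (QuotientGroup.eq.1 h) x.2⁻¹
    simpa [mul_assoc] using h'
  · intro q
    obtain ⟨x, rfl⟩ := QuotientGroup.mk_surjective q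
    exact ⟨Quotient.mk'' (x, 1), by simp [Quotient.liftOn'_mk'']⟩

theorem relIndex_fiberSubgroup (n : ℕ) :
    (fiberSubgroup G p n).relIndex (Subgroup.prod ⊤ ⊥) = (lowerPCentral G p n).index := by
  have h1 : Subgroup.prod ⊤ ⊥ = (MonoidHom.inl G G).range := by
    ext ⟨x, y⟩
    simp [Subgroup.mem_prod, eq_comm]
  have h2 : (fiberSubgroup G p n).comap (MonoidHom.inl G G) = lowerPCentral G p n := by
    ext x
    simp [mem_fiberSubgroup]
  rw [h1, ← Subgroup.index_comap, h2]

theorem finiteIndex_fiberSubgroup [Group.FG G] (hp : p.Prime) {n : ℕ} (hn : 1 ≤ n) :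
    (fiberSubgroup G p n).FiniteIndex :=
  ⟨by rw [index_fiberSubgroup]; exact (finiteIndex_lowerPCentral hp hn).index_ne_zero⟩

theorem map_fst_fiberSubgroup (n : ℕ) :
    (fiberSubgroup G p n).map (MonoidHom.fst G G) = ⊤ :=
  eq_top_iff.2 fun x _ => ⟨(x, x), mem_fiberSubgroup.2 (by simp), rfl⟩

theorem map_snd_fiberSubgroup (n : ℕ) :
    (fiberSubgroup G p n).map (MonoidHom.snd G G) = ⊤ :=
  eq_top_iff.2 fun x _ => ⟨(x, x), mem_fiberSubgroup.2 (by simp), rfl⟩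

/-- Rank does not increase under the surjection onto `Pₙ / Pₙ₊₁`, and an abelian group of exponent
dividing `p` with `d` generators has order dividing `p ^ d`. -/
theorem pCentralExp_le_rank (hp : p.Prime) {n : ℕ} (hn : 1 ≤ n)
    [Group.FG (lowerPCentral G p n)] [Group.FG (fiberSubgroup G p n)] :
    pCentralExp G p n ≤ Group.rank (fiberSubgroup G p n) := by
  let := pCentralQuotientCommGroup G p hn
  have : Group.FG (pCentralQuotient G p n) := QuotientGroup.fg _
  have h1 := Group.rank_le_of_surjective _ (fiberSubgroupToQuotient_surjective (G := G) (p := p) hn)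
  have h2 := card_dvd_exponent_pow_rank' (pCentralQuotient G p n)
    (fun x => pCentralQuotient_pow_eq_one hn x)
  rw [card_pCentralQuotient hp hn, Nat.pow_dvd_pow_iff_le_right hp.one_lt] at h2
  exact h2.trans h1

end LowerPCentral

/-! ### Growth of `aₙ` and `bₙ`, and the asymptotic statements -/

theorem lt_pCentralExp {p : ℕ} (hp : p.Prime) {n : ℕ} (hn : 1 ≤ n) {s : ℝ} (hs : 1 < s) :
    (2 - s) * s ^ (n - 1) < pCentralExp F₂ p n := by
  have := finiteIndex_lowerPCentral (G := F₂) hp hn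
  obtain ⟨r, hr, hS⟩ := exists_generators_lowerPCentral (G := F₂) hp hn
  exact golodShafarevich_lowerPCentral hp n hn r hr hS hs

theorem pCentralExp_pos {p : ℕ} (hp : p.Prime) {n : ℕ} (hn : 1 ≤ n) :
    0 < pCentralExp F₂ p n := by
  have h := lt_pCentralExp hp hn (s := 3 / 2) (by norm_num)
  have : (0 : ℝ) < pCentralExp F₂ p n := lt_trans (by positivity) h
  exact_mod_cast this

theorem le_pCentralExpSum {p : ℕ} (hp : p.Prime) (n : ℕ) : n ≤ pCentralExpSum F₂ p n := by
  induction n with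
  | zero => simp
  | succ n ih =>
    have := pCentralExp_pos hp (n := n + 1) (by omega)
    rw [pCentralExpSum_succ]
    omega

/-- A sequence that grows faster than every exponential of base less than two satisfies
`(2 - ε) b n ≤ b (n + 1)` infinitely often. -/
theorem frequently_mul_le_succ_of_exponential_growth {b : ℕ → ℝ}
    (hb : ∀ s : ℝ, 1 < s → s < 2 → ∀ n, (2 - s) * s ^ n ≤ b (n + 1)) {ε : ℝ} (hε : 0 < ε)
    (hε' : ε < 1) : ∃ᶠ n in atTop, (2 - ε) * b n ≤ b (n + 1) := by
  intro h
  obtain ⟨N, hN⟩ := eventually_atTop.1 h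
  have hbound : ∀ j, b (N + j) ≤ (2 - ε) ^ j * b N := by
    intro j
    induction j with
    | zero => simp
    | succ j ih =>
      have h1 := not_le.1 (hN (N + j) (by omega))
      calc b (N + (j + 1)) ≤ (2 - ε) * b (N + j) := h1.le
        _ ≤ (2 - ε) * ((2 - ε) ^ j * b N) := by gcongr; linarith
        _ = _ := by ring
  -- Any `s` strictly between `2 - ε` and `2` works: `s ^ j` outgrows `(2 - ε) ^ j`, while the
  -- factor `2 - s` stays positive.
  set s := 2 - ε / 2 with hs
  have h2 : 0 < 2 - ε := by linarith
  obtain ⟨j, hj⟩ := pow_unbounded_of_one_lt ((2 - ε) * b N / (ε / 2))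
    ((one_lt_div h2).2 (by linarith : 2 - ε < s))
  have h3 := hb s (by linarith) (by linarith) (N + j)
  have h4 := hbound (j + 1)
  rw [← add_assoc] at h4
  have h5 : s ^ j ≤ s ^ (N + j) := pow_le_pow_right₀ (by linarith) (by omega)
  have h6 : (ε / 2) * s ^ j ≤ (2 - ε) ^ (j + 1) * b N := by
    refine le_trans ?_ (h3.trans h4)
    rw [show 2 - s = ε / 2 by rw [hs]; ring]
    gcongr
  rw [div_lt_iff₀ (by positivity), div_pow, div_mul_eq_mul_div, lt_div_iff₀ (by positivity)] at hj
  rw [pow_succ] at h6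
  nlinarith

theorem frequently_le_pCentralExp_div {p : ℕ} (hp : p.Prime) {ε : ℝ} (hε : 0 < ε) :
    ∃ᶠ n in atTop, 2 ≤ n ∧
      1 - ε ≤ (pCentralExp F₂ p n : ℝ) / pCentralExpSum F₂ p (n - 1) := by
  have hb : ∀ s : ℝ, 1 < s → s < 2 → ∀ n, (2 - s) * s ^ n ≤ (pCentralExpSum F₂ p (n + 1) : ℝ) := by
    intro s hs _ n
    have h := lt_pCentralExp hp (n := n + 1) (by omega) hs
    rw [pCentralExpSum_succ]
    push_cast
    have : (0 : ℝ) ≤ pCentralExpSum F₂ p n := by positivity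
    simp only [add_tsub_cancel_right] at h
    linarith
  have hf := frequently_mul_le_succ_of_exponential_growth (b := fun n => (pCentralExpSum F₂ p n : ℝ))
    hb (ε := min ε (1 / 2)) (by positivity) ((min_le_right _ _).trans_lt (by norm_num))
  -- Since `bₙ₊₁ = bₙ + aₙ₊₁`, the inequality `(2 - ε) bₙ ≤ bₙ₊₁` reads `(1 - ε) bₙ ≤ aₙ₊₁`; the
  -- index shifts by one, and `n ≥ 1` ensures `bₙ > 0`.
  refine (tendsto_add_atTop_nat 1).frequently
    ((hf.and_eventually (eventually_ge_atTop 1)).mono ?_)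
  rintro n ⟨h, hn⟩
  refine ⟨by omega, ?_⟩
  rw [pCentralExpSum_succ] at h
  push_cast at h
  have hpos : (0 : ℝ) < pCentralExpSum F₂ p n := by
    exact_mod_cast lt_of_lt_of_le hn (le_pCentralExpSum hp n)
  rw [Nat.add_sub_cancel, le_div_iff₀ hpos]
  have := mul_le_mul_of_nonneg_right (min_le_left ε (1 / 2)) hpos.le
  linarith

theorem logb_index_fiberSubgroup {p : ℕ} (hp : p.Prime) {n : ℕ} (hn : 1 ≤ n) :
    Real.logb p (fiberSubgroup F₂ p n).index = pCentralExpSum F₂ p (n - 1) := by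
  rw [index_fiberSubgroup, index_lowerPCentral hp hn, Nat.cast_pow, Real.logb_pow,
    Real.logb_self_eq_one (by exact_mod_cast hp.one_lt), mul_one]

theorem frequently_rank_fiberSubgroup {p : ℕ} (hp : p.Prime) {ε : ℝ} (hε : 0 < ε) :
    ∃ᶠ n : ℕ in atTop,
      0 < pCentralExpSum F₂ p (n - 1) ∧
      ∃ _ : (fiberSubgroup F₂ p n).FiniteIndex,
        (1 - ε) * Real.logb p (fiberSubgroup F₂ p n).index ≤ Group.rank (fiberSubgroup F₂ p n) ∧
        (pCentralExp F₂ p n : ℝ) / pCentralExpSum F₂ p (n - 1) ≤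
          Group.rank (fiberSubgroup F₂ p n) / Real.logb p (fiberSubgroup F₂ p n).index ∧
        1 - ε ≤ (pCentralExp F₂ p n : ℝ) / pCentralExpSum F₂ p (n - 1) := by
  refine (frequently_le_pCentralExp_div hp hε).mono ?_
  rintro n ⟨hn, h⟩
  have hn1 : 1 ≤ n := by omega
  have hpos : 0 < pCentralExpSum F₂ p (n - 1) :=
    lt_of_lt_of_le (by omega) (le_pCentralExpSum hp (n - 1))
  have hpos' : (0 : ℝ) < pCentralExpSum F₂ p (n - 1) := by exact_mod_cast hpos
  have := finiteIndex_lowerPCentral (G := F₂) hp hn1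
  have hU := finiteIndex_fiberSubgroup (G := F₂) hp hn1
  have hrank : (pCentralExp F₂ p n : ℝ) ≤ Group.rank (fiberSubgroup F₂ p n) := by
    exact_mod_cast pCentralExp_le_rank (G := F₂) hp hn1
  refine ⟨hpos, hU, ?_, ?_, h⟩
  · rw [logb_index_fiberSubgroup hp hn1]
    exact ((le_div_iff₀ hpos').1 h).trans hrank
  · rw [logb_index_fiberSubgroup hp hn1]
    gcongr

/-- Needed to turn infinitely many `n` into infinitely many values `m` of the index. -/
theorem tendsto_index_fiberSubgroup {p : ℕ} (hp : p.Prime) :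
    Tendsto (fun n => (fiberSubgroup F₂ p n).index) atTop atTop := by
  rw [← tendsto_add_atTop_iff_nat 1]
  refine tendsto_atTop_mono (fun n => ?_) tendsto_id
  rw [index_fiberSubgroup, index_lowerPCentral hp (by omega), Nat.add_sub_cancel]
  exact (Nat.lt_pow_self hp.one_lt).le.trans
    (Nat.pow_le_pow_right hp.pos (le_pCentralExpSum hp n))

theorem mainTheorem8 (p : ℕ) (hp : p.Prime) :
    -- the elementary abelian quotients, the indices, the surjections and `d(Uₙ) ≥ aₙ`
    (∀ n : ℕ, 1 ≤ n →
      lowerPCentral F₂ p (n + 1) ≤ lowerPCentral F₂ p n ∧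
      (∀ x y : pCentralQuotient F₂ p n, x * y = y * x) ∧
      (∀ x : pCentralQuotient F₂ p n, x ^ p = 1) ∧
      Nat.card (pCentralQuotient F₂ p n) = p ^ pCentralExp F₂ p n ∧
      (fiberSubgroup F₂ p n).index = p ^ pCentralExpSum F₂ p (n - 1) ∧
      (fiberSubgroup F₂ p n).relIndex (Subgroup.prod ⊤ ⊥) = p ^ pCentralExpSum F₂ p (n - 1) ∧
      (∃ φ : fiberSubgroup F₂ p n →* pCentralQuotient F₂ p n, Function.Surjective φ) ∧
      ∃ _ : (fiberSubgroup F₂ p n).FiniteIndex,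
        pCentralExp F₂ p n ≤ Group.rank (fiberSubgroup F₂ p n)) ∧
    -- the lower bound for infinitely many `n`
    (∀ ε : ℝ, 0 < ε → ∃ᶠ n : ℕ in atTop,
      0 < pCentralExpSum F₂ p (n - 1) ∧
      ∃ _ : (fiberSubgroup F₂ p n).FiniteIndex,
        (1 - ε) * Real.logb p (fiberSubgroup F₂ p n).index ≤ Group.rank (fiberSubgroup F₂ p n) ∧
        (pCentralExp F₂ p n : ℝ) / pCentralExpSum F₂ p (n - 1) ≤
          Group.rank (fiberSubgroup F₂ p n) / Real.logb p (fiberSubgroup F₂ p n).index ∧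
        1 - ε ≤ (pCentralExp F₂ p n : ℝ) / pCentralExpSum F₂ p (n - 1)) ∧
    -- sharpness of a logarithmic bound in terms of the index, for finite index subgroups that
    -- project onto both factors
    (∀ f : ℕ → ℝ,
      (∀ (H : Subgroup (F₂ × F₂)) [H.FiniteIndex],
        H.map (MonoidHom.fst F₂ F₂) = ⊤ → H.map (MonoidHom.snd F₂ F₂) = ⊤ →
          (Group.rank H : ℝ) ≤ f H.index) →
      ∀ ε : ℝ, 0 < ε → ∃ᶠ m : ℕ in atTop, (1 - ε) * Real.logb p m ≤ f m) := by
  refine ⟨fun n hn => ?_, fun ε hε => frequently_rank_fiberSubgroup hp hε, fun f hf ε hε => ?_⟩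
  · have := finiteIndex_lowerPCentral (G := F₂) hp hn
    have hU := finiteIndex_fiberSubgroup (G := F₂) hp hn
    refine ⟨lowerPCentral_succ_le n hn, pCentralQuotient_mul_comm hn,
      pCentralQuotient_pow_eq_one hn, card_pCentralQuotient hp hn, ?_, ?_,
      ⟨_, fiberSubgroupToQuotient_surjective hn⟩, hU, pCentralExp_le_rank hp hn⟩
    · rw [index_fiberSubgroup, index_lowerPCentral hp hn]
    · rw [relIndex_fiberSubgroup, index_lowerPCentral hp hn]
  · refine (tendsto_index_fiberSubgroup hp).frequently
      ((frequently_rank_fiberSubgroup hp hε).mono ?_)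
    rintro n ⟨-, hU, h, -⟩
    exact h.trans (hf _ (map_fst_fiberSubgroup n) (map_snd_fiberSubgroup n))
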